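/- Let $\Bbbk$ be a field of characteristic zero, let $n=2m+1$ be an odd integer, and let $S=\Bbbk[x_1,\ldots,x_n]$ with the standard grading. For a homogeneous ideal $I\subset S$ with $A=S/I$ artinian, we say that $A$ *fails the WLP in degree $i$* if for every linear form $\ell\in A_1$ the multiplication map $\times\ell\colon A_i\to A_{i+1}$ is neither injective nor surjective. 1. Let $d\ge 5$ and $n\ge 5$, and let $I=(x_1^d,\ldots,x_n^d,\;x_1^{\lceil d/2\rceil}x_2^{\lfloor d/2\rfloor})$. Then $S/I$ fails the WLP in degree $\left\lfloor \frac{n(d-1)}{2}\right\rfloor-1$. 2. Let $n\ge 5$, and let $I=(x_1^4,\ldots,x_n^4,\;x_1x_2x_3x_4)$. Then $S/I$ fails the WLP in degree $3m$. 3. Let $n\ge 3$, and let $I=(x_1^3,\ldots,x_n^3,\;x_1x_2x_3)$. Then $S/I$ fails the WLP in degree $2m$. -/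

import Mathlib

/-- The degree-`i` graded piece `A_i` of `A = K[x_1, …, x_n] / I` (for a homogeneous ideal `I`): the
image in the quotient of the homogeneous polynomials of degree `i`. -/
noncomputable def gradedPiece {K : Type*} [Field K] {n : ℕ} (I : Ideal (MvPolynomial (Fin n) K)) (i : ℕ) :
    Submodule K (MvPolynomial (Fin n) K ⧸ I) :=
  (MvPolynomial.homogeneousSubmodule (Fin n) K i).map (Ideal.Quotient.mkₐ K I).toLinearMap

theorem mul_mem_gradedPiece {K : Type*} [Field K] {n : ℕ} {I : Ideal (MvPolynomial (Fin n) K)}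
    {i : ℕ} {l a : MvPolynomial (Fin n) K ⧸ I} (hl : l ∈ gradedPiece I 1)
    (ha : a ∈ gradedPiece I i) : l * a ∈ gradedPiece I (i + 1) := by
  obtain ⟨p, hp, rfl⟩ := hl
  obtain ⟨q, hq, rfl⟩ := ha
  refine ⟨p * q, ?_, by simp⟩
  have h := MvPolynomial.IsHomogeneous.mul (show p.IsHomogeneous 1 from hp)
    (show q.IsHomogeneous i from hq)
  rw [add_comm] at h
  exact h

/-- Multiplication by a linear form `l ∈ A_1`, as a `K`-linear map `A_i → A_{i+1}`. -/
noncomputable def mulLinearForm {K : Type*} [Field K] {n : ℕ} (I : Ideal (MvPolynomial (Fin n) K))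
    (l : gradedPiece I 1) (i : ℕ) : gradedPiece I i →ₗ[K] gradedPiece I (i + 1) :=
  (LinearMap.mulLeft K (l : MvPolynomial (Fin n) K ⧸ I)).restrict
    fun _ ha => mul_mem_gradedPiece l.2 ha

/-- `A = K[x_1, …, x_n] / I` fails the weak Lefschetz property in degree `i`: there is no linear
form `l ∈ A_1` for which multiplication `A_i → A_{i+1}` has maximal rank, that is, is injective
or surjective. -/
def FailsWLPInDegree {K : Type*} [Field K] {n : ℕ} (I : Ideal (MvPolynomial (Fin n) K))
    (i : ℕ) : Prop :=
  ∀ l : gradedPiece I 1, ¬ (Function.Injective (mulLinearForm I l i) ∨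
    Function.Surjective (mulLinearForm I l i))

/-- The ideal `(x_1^d, …, x_n^d, u)` of `K[x_1, …, x_n]`. -/
noncomputable def powersAnd {K : Type*} [Field K] {n : ℕ} (d : ℕ) (u : MvPolynomial (Fin n) K) :
    Ideal (MvPolynomial (Fin n) K) :=
  Ideal.span (Set.range (fun i : Fin n => (MvPolynomial.X i : MvPolynomial (Fin n) K) ^ d) ∪ {u})


/-!
For an artinian monomial quotient, maximal rank is an open condition on the linear form and almost
all linear forms are rescalings of `ℓ = ∑ x_i`, so it suffices to treat `ℓ`: one needs a nonzero
kernel element, and a nonzero element of the cokernel.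

Kernel. Split the variables into blocks `V ⊔ W`, with block sums `x` and `y`. If `x ^ N f = 0` and
`y ^ N g = 0`, then `x + y` kills `f g ∑ x ^ j (-y) ^ (N - 1 - j)`, and this is nonzero once
`x ^ p f ≠ 0` and `y ^ q g ≠ 0` for some `p + q = N - 1`. One block carries the extra generator of the
ideal; the variables outside a starting set of three or five are added in pairs, a pair
contributing a form of degree `d - 1` killed by `x_i + x_j`.

Cokernel. A translation invariant form `F` supported on standard monomials annihilates both the ideal
and the multiples of `ℓ` in the differentiation pairing, hence shows that `ℓ` is not surjective onto
the degree of `F`. The forms used are products of differences of variables (and, for fourth powers,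
one invariant quadric); each added pair contributes `(x_i - x_j) ^ (d - 1)`.
-/

open MvPolynomial

section Perturbation

variable {K V W : Type*} [Field K] [AddCommGroup V] [Module K V] [AddCommGroup W] [Module K W]

theorem finite_setOf_not_injective_one_add_smul [FiniteDimensional K V] (E : Module.End K V) :
    {t : K | ¬ Function.Injective (1 + t • E : Module.End K V)}.Finite := by
  refine ((Module.End.finite_hasEigenvalue E).preimage (f := fun t => -t⁻¹)
    (fun a _ b _ hab => by simpa using hab)).subset fun t ht => ?_
  obtain ⟨v, hv, hv₀⟩ : ∃ v, v + t • E v = 0 ∧ v ≠ 0 := by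
    simpa [injective_iff_map_eq_zero] using ht
  have ht₀ : t ≠ 0 := by rintro rfl; simp [hv₀] at hv
  refine Module.End.hasEigenvalue_of_hasEigenvector (x := v) ⟨?_, hv₀⟩
  rw [Module.End.mem_eigenspace_iff, eq_neg_of_add_eq_zero_left hv, neg_smul, smul_neg, neg_neg,
    inv_smul_smul₀ ht₀, ← eq_neg_of_add_eq_zero_left hv]

theorem finite_setOf_not_injective_add_smul [FiniteDimensional K V] {f : V →ₗ[K] W}
    (hf : Function.Injective f) (g : V →ₗ[K] W) :
    {t : K | ¬ Function.Injective (f + t • g)}.Finite := by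
  obtain ⟨f', hf'⟩ := f.exists_leftInverse_of_injective (LinearMap.ker_eq_bot.mpr hf)
  refine (finite_setOf_not_injective_one_add_smul (f' ∘ₗ g)).subset fun t ht h => ht ?_
  have hcomp : (1 + t • (f' ∘ₗ g) : Module.End K V) = f' ∘ₗ (f + t • g) := by
    rw [LinearMap.comp_add, hf', LinearMap.comp_smul, Module.End.one_eq_id]
  rw [hcomp] at h
  exact Function.Injective.of_comp h

theorem finite_setOf_not_surjective_add_smul [FiniteDimensional K W] {f : V →ₗ[K] W}
    (hf : Function.Surjective f) (g : V →ₗ[K] W) :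
    {t : K | ¬ Function.Surjective (f + t • g)}.Finite := by
  refine (finite_setOf_not_injective_add_smul (LinearMap.dualMap_injective_iff.mpr hf)
    g.dualMap).subset fun t ht h => ht ?_
  have hdual : (f + t • g).dualMap = f.dualMap + t • g.dualMap := by ext; simp
  rwa [← LinearMap.dualMap_injective_iff, hdual]

theorem exists_notMem_forall_add_smul_one_ne_zero [Infinite K] {ι : Type*} [Finite ι] (c : ι → K)
    {B : Set K} (hB : B.Finite) : ∃ t ∉ B, ∀ i, (c + t • 1) i ≠ 0 := by
  obtain ⟨t, ht⟩ := (hB.union (Set.finite_range fun i => -c i)).infinite_compl.nonempty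
  rw [Set.mem_compl_iff, Set.mem_union, not_or] at ht
  refine ⟨t, ht.1, fun i hi => ht.2 ⟨i, (eq_neg_of_add_eq_zero_right ?_).symm⟩⟩
  simpa using hi

end Perturbation

section Rescaling

variable {K : Type*} [Field K]

/-- The substitution `x_i ↦ c_i x_i`. -/
noncomputable def rescale {σ : Type*} (c : σ → K) : MvPolynomial σ K →ₐ[K] MvPolynomial σ K :=
  aeval fun i => c i • X i

@[simp]
theorem rescale_X {σ : Type*} (c : σ → K) (i : σ) : rescale c (X i) = c i • X i :=
  aeval_X _ i

theorem rescale_inv_rescale {σ : Type*} {c : σ → K} (hc : ∀ i, c i ≠ 0) (p : MvPolynomial σ K) :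
    rescale c⁻¹ (rescale c p) = p := by
  suffices (rescale c⁻¹).comp (rescale c) = AlgHom.id K _ from DFunLike.congr_fun this p
  refine algHom_ext fun i => ?_
  rw [AlgHom.comp_apply, rescale_X, map_smul, rescale_X, Pi.inv_apply, smul_inv_smul₀ (hc i),
    AlgHom.id_apply]

theorem isHomogeneous_smul_X {σ : Type*} (r : K) (i : σ) :
    (r • X i : MvPolynomial σ K).IsHomogeneous 1 :=
  Submodule.smul_mem (homogeneousSubmodule σ K 1) r (isHomogeneous_X K i)

theorem isHomogeneous_rescale {σ : Type*} (c : σ → K) {p : MvPolynomial σ K} {t : ℕ}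
    (hp : p.IsHomogeneous t) : (rescale c p).IsHomogeneous t := by
  have := hp.aeval (fun i => c i • X i) fun i => isHomogeneous_smul_X (c i) i
  rwa [one_mul] at this

variable {n : ℕ} {I : Ideal (MvPolynomial (Fin n) K)}

instance gradedPiece_finite (i : ℕ) : Module.Finite K (gradedPiece I i) :=
  Module.Finite.iff_fg.mpr ((homogeneousSubmodule_fg (Fin n) K i).map _)

theorem mulLinearForm_add_smul (l l' : gradedPiece I 1) (t : K) (i : ℕ) :
    mulLinearForm I (l + t • l') i = mulLinearForm I l i + t • mulLinearForm I l' i := by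
  refine LinearMap.ext fun a => Subtype.ext ?_
  change ((l : MvPolynomial (Fin n) K ⧸ I) + t • ↑l') * ↑a = ↑l * ↑a + t • (↑l' * ↑a)
  rw [add_mul, smul_mul_assoc]

/-- The class in `A_1` of the linear form `∑ c_i x_i`, as a linear function of `c`. -/
noncomputable def linearClass (I : Ideal (MvPolynomial (Fin n) K)) :
    (Fin n → K) →ₗ[K] gradedPiece I 1 :=
  ((Ideal.Quotient.mkₐ K I).toLinearMap ∘ₗ Fintype.linearCombination K X).codRestrict _ fun c =>
    ⟨∑ i, c i • X i, IsHomogeneous.sum _ _ _ fun i _ => isHomogeneous_smul_X (c i) i, rfl⟩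

theorem linearClass_surjective : Function.Surjective (linearClass I) := by
  rintro ⟨_, p, hp, rfl⟩
  rw [homogeneousSubmodule_one_eq_span_X, SetLike.mem_coe,
    Submodule.mem_span_range_iff_exists_fun] at hp
  obtain ⟨c, rfl⟩ := hp
  exact ⟨c, rfl⟩

theorem rescale_sum_X (c : Fin n → K) : rescale c (∑ j, X j) = ∑ j, c j • X j := by
  simp only [map_sum, rescale_X]

theorem not_injective_mulLinearForm (hI : ∀ c : Fin n → K, I ≤ I.comap (rescale c)) {c : Fin n → K}
    (hc : ∀ j, c j ≠ 0) {i : ℕ} {p : MvPolynomial (Fin n) K} (hp : p.IsHomogeneous i) (hpI : p ∉ I)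
    (hmul : (∑ j, X j) * p ∈ I) :
    ¬ Function.Injective (mulLinearForm I (linearClass I c) i) := by
  have hmul' : (∑ j, c j • X j) * rescale c p ∈ I := by
    rw [← rescale_sum_X, ← map_mul]
    exact hI c hmul
  rw [injective_iff_map_eq_zero]
  intro h
  have hp₀ := h ⟨Ideal.Quotient.mkₐ K I (rescale c p), _, isHomogeneous_rescale c hp, rfl⟩
    (Subtype.ext (Ideal.Quotient.eq_zero_iff_mem.mpr hmul'))
  have hpI' : rescale c p ∈ I := Ideal.Quotient.eq_zero_iff_mem.mp (congrArg Subtype.val hp₀)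
  have hpI'' := hI c⁻¹ hpI'
  rw [Ideal.mem_comap, rescale_inv_rescale hc] at hpI''
  exact hpI hpI''

theorem not_surjective_mulLinearForm (hI : ∀ c : Fin n → K, I ≤ I.comap (rescale c))
    {c : Fin n → K} (hc : ∀ j, c j ≠ 0) {i : ℕ} {q : MvPolynomial (Fin n) K}
    (hq : q.IsHomogeneous (i + 1)) (hqI : q ∉ Ideal.span {∑ j, X j} ⊔ I) :
    ¬ Function.Surjective (mulLinearForm I (linearClass I c) i) := by
  intro h
  obtain ⟨⟨_, p, hp, rfl⟩, hpq⟩ :=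
    h ⟨Ideal.Quotient.mkₐ K I (rescale c q), _, isHomogeneous_rescale c hq, rfl⟩
  have hmem : rescale c q - (∑ j, c j • X j) * p ∈ I :=
    Ideal.Quotient.eq.mp (congrArg Subtype.val hpq).symm
  rw [← rescale_sum_X] at hmem
  have hmem' := hI c⁻¹ hmem
  rw [Ideal.mem_comap, map_sub, map_mul, rescale_inv_rescale hc, rescale_inv_rescale hc] at hmem'
  exact hqI (Ideal.mem_span_singleton_sup.mpr ⟨rescale c⁻¹ p, _, hmem', by ring⟩)

theorem failsWLPInDegree_of_sum_X [Infinite K] (hI : ∀ c : Fin n → K, I ≤ I.comap (rescale c))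
    {i : ℕ} {p q : MvPolynomial (Fin n) K} (hp : p.IsHomogeneous i) (hpI : p ∉ I)
    (hmul : (∑ j, X j) * p ∈ I) (hq : q.IsHomogeneous (i + 1))
    (hqI : q ∉ Ideal.span {∑ j, X j} ⊔ I) : FailsWLPInDegree I i := by
  intro l hl
  obtain ⟨c, rfl⟩ := linearClass_surjective l
  have hline (t : K) : mulLinearForm I (linearClass I c) i + t • mulLinearForm I (linearClass I 1) i
      = mulLinearForm I (linearClass I (c + t • 1)) i := by
    rw [map_add, map_smul, mulLinearForm_add_smul]
  rcases hl with hinj | hsurj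
  · have hfin := finite_setOf_not_injective_add_smul hinj (mulLinearForm I (linearClass I 1) i)
    simp only [hline] at hfin
    obtain ⟨t, ht, hc⟩ := exists_notMem_forall_add_smul_one_ne_zero c hfin
    exact ht (not_injective_mulLinearForm hI hc hp hpI hmul)
  · have hfin := finite_setOf_not_surjective_add_smul hsurj (mulLinearForm I (linearClass I 1) i)
    simp only [hline] at hfin
    obtain ⟨t, ht, hc⟩ := exists_notMem_forall_add_smul_one_ne_zero c hfin
    exact ht (not_surjective_mulLinearForm hI hc hq hqI)

end Rescaling

section Monomials

theorem support_subset_of_mem_supported {σ R : Type*} [CommSemiring R] {V : Set σ}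
    {p : MvPolynomial σ R} (hp : p ∈ supported R V) {a : σ →₀ ℕ} (ha : a ∈ p.support) :
    (a.support : Set σ) ⊆ V := fun i hi =>
  mem_supported.mp hp ((mem_vars_iff_mem_support i).mpr ⟨a, ha, hi⟩)

theorem coeff_add_mul_of_disjoint {σ R : Type*} [CommSemiring R] {V W : Set σ}
    (hVW : Disjoint V W) {p q : MvPolynomial σ R} (hp : p ∈ supported R V)
    (hq : q ∈ supported R W) {a b : σ →₀ ℕ} (ha : (a.support : Set σ) ⊆ V)
    (hb : (b.support : Set σ) ⊆ W) : coeff (a + b) (p * q) = coeff a p * coeff b q := by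
  classical
  have hzero {a : σ →₀ ℕ} {U : Set σ} (ha : (a.support : Set σ) ⊆ U) {i : σ} (hi : i ∉ U) :
      a i = 0 := Finsupp.notMem_support_iff.mp fun h => hi (ha h)
  rw [coeff_mul, Finset.sum_eq_single_of_mem (a, b) (by simp)]
  rintro ⟨a', b'⟩ hab hne
  by_contra h
  have ha' := support_subset_of_mem_supported hp (mem_support_iff.mpr (left_ne_zero_of_mul h))
  have hb' := support_subset_of_mem_supported hq (mem_support_iff.mpr (right_ne_zero_of_mul h))
  rw [Finset.HasAntidiagonal.mem_antidiagonal] at hab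
  refine hne ?_
  have haa : a' = a := by
    ext i
    by_cases hi : i ∈ V
    · have hiW := Set.disjoint_left.mp hVW hi
      simpa [hzero hb hiW, hzero hb' hiW] using DFunLike.congr_fun hab i
    · rw [hzero ha hi, hzero ha' hi]
  rw [haa, add_right_inj] at hab
  exact Prod.ext haa hab

/-- `x^a` is a standard monomial for `(x_1^d, …, x_n^d, x^u)`, i.e. lies outside that ideal. -/
def IsStandard {σ : Type*} (d : ℕ) (u a : σ →₀ ℕ) : Prop := (∀ i, a i < d) ∧ ¬ u ≤ a

theorem IsStandard.add {σ : Type*} {d : ℕ} {u a b : σ →₀ ℕ} {V W : Set σ} (hVW : Disjoint V W)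
    (hu : (u.support : Set σ) ⊆ V) (ha : (a.support : Set σ) ⊆ V) (hb : (b.support : Set σ) ⊆ W)
    (hua : IsStandard d u a) (hbd : ∀ i, b i < d) : IsStandard d u (a + b) := by
  have hb₀ {i : σ} (hi : i ∈ V) : b i = 0 :=
    Finsupp.notMem_support_iff.mp fun h => Set.disjoint_left.mp hVW hi (hb h)
  refine ⟨fun i => ?_, fun h => hua.2 fun i => ?_⟩ <;> by_cases hi : i ∈ V
  · simpa [hb₀ hi] using hua.1 i
  · simpa [Finsupp.notMem_support_iff.mp fun h => hi (ha h)] using hbd i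
  · simpa [hb₀ hi] using h i
  · simp [Finsupp.notMem_support_iff.mp fun h => hi (hu h)]

theorem isStandard_of_degree_lt {σ : Type*} {d : ℕ} {u a : σ →₀ ℕ} (ha : a.degree < d)
    (hu : d ≤ u.degree) : IsStandard d u a :=
  ⟨fun i => (Finsupp.le_degree i a).trans_lt ha,
    fun h => (ha.trans_le hu).not_ge (Finsupp.degree_mono h)⟩

theorem degree_eq_of_mem_support {σ R : Type*} [CommSemiring R] {p : MvPolynomial σ R} {t : ℕ}
    (hp : p.IsHomogeneous t) {a : σ →₀ ℕ} (ha : a ∈ p.support) : a.degree = t := by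
  by_contra h
  exact mem_support_iff.mp ha (hp.coeff_eq_zero h)

theorem mem_restrictSupport_of_mem_supported {σ R : Type*} [CommSemiring R] {V : Set σ}
    {p : MvPolynomial σ R} (hp : p ∈ supported R V) {u : σ →₀ ℕ} {i : σ} (hi : i ∉ V)
    (hui : u i ≠ 0) : p ∈ restrictSupport R {a | ¬ u ≤ a} :=
  (mem_restrictSupport_iff R).mpr fun _ ha h =>
    hi (support_subset_of_mem_supported hp ha
      (Finsupp.mem_support_iff.mpr ((Nat.pos_of_ne_zero hui).trans_le (h i)).ne'))

variable {K : Type*} [Field K] {n d t : ℕ} {u : Fin n →₀ ℕ} {p : MvPolynomial (Fin n) K}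

theorem mem_powersAnd_monomial :
    p ∈ powersAnd d (monomial u 1) ↔ ∀ a ∈ p.support, ¬ IsStandard d u a := by
  have hspan : powersAnd d (monomial u (1 : K)) = Ideal.span ((fun a => monomial a (1 : K)) ''
      (Set.range (fun i : Fin n => Finsupp.single i d) ∪ {u})) := by
    rw [powersAnd, Set.image_union, Set.image_singleton, ← Set.range_comp]
    simp only [Function.comp_def, X_pow_eq_monomial]
  rw [hspan, mem_ideal_span_monomial_image]
  refine forall₂_congr fun a _ => ?_
  simp [IsStandard, imp_iff_or_not]

theorem notMem_powersAnd_monomial :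
    p ∉ powersAnd d (monomial u 1) ↔ ∃ a ∈ p.support, IsStandard d u a := by
  simp [mem_powersAnd_monomial]

theorem X_pow_mem_powersAnd (u : MvPolynomial (Fin n) K) (i : Fin n) :
    (X i ^ d : MvPolynomial (Fin n) K) ∈ powersAnd d u :=
  Ideal.subset_span (Or.inl ⟨i, rfl⟩)

theorem self_mem_powersAnd (u : MvPolynomial (Fin n) K) : u ∈ powersAnd d u :=
  Ideal.subset_span (Or.inr rfl)

theorem isStandard_of_mem_support_of_lt (hp : p.IsHomogeneous t) (ht : t < d) (hu : d ≤ u.degree)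
    {a : Fin n →₀ ℕ} (ha : a ∈ p.support) : IsStandard d u a :=
  isStandard_of_degree_lt ((degree_eq_of_mem_support hp ha).trans_lt ht) hu

theorem notMem_powersAnd_of_isHomogeneous (hp₀ : p ≠ 0) (hp : p.IsHomogeneous t) (ht : t < d)
    (hu : d ≤ u.degree) : p ∉ powersAnd d (monomial u 1) := by
  obtain ⟨a, ha⟩ := support_nonempty.mpr hp₀
  exact notMem_powersAnd_monomial.mpr ⟨a, ha, isStandard_of_mem_support_of_lt hp ht hu ha⟩

theorem powersAnd_monomial_le_comap_rescale (c : Fin n → K) :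
    powersAnd d (monomial u 1) ≤ (powersAnd d (monomial u 1)).comap (rescale c) := by
  rw [powersAnd, Ideal.span_le, Set.union_subset_iff, Set.range_subset_iff,
    Set.singleton_subset_iff, ← powersAnd]
  refine ⟨fun i => ?_, ?_⟩
  · rw [SetLike.mem_coe, Ideal.mem_comap, map_pow, rescale_X, smul_pow]
    exact Submodule.smul_of_tower_mem _ _ (X_pow_mem_powersAnd _ i)
  · rw [SetLike.mem_coe, Ideal.mem_comap, rescale, aeval_monomial, map_one (algebraMap _ _),
      one_mul]
    have hu := self_mem_powersAnd (d := d) (monomial u (1 : K))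
    rw [monomial_eq, C_1, one_mul] at hu ⊢
    simp only [Finsupp.prod, smul_pow, Finset.prod_smul] at hu ⊢
    exact Submodule.smul_of_tower_mem _ _ hu

end Monomials

section KernelForms

variable {K : Type*} [Field K] {n d : ℕ} {u v : Fin n →₀ ℕ}

theorem isHomogeneous_sum_X (V : Finset (Fin n)) :
    (∑ i ∈ V, X i : MvPolynomial (Fin n) K).IsHomogeneous 1 :=
  IsHomogeneous.sum _ _ _ fun i _ => isHomogeneous_X K i

theorem sum_X_mem_supported (V : Finset (Fin n)) :
    (∑ i ∈ V, X i : MvPolynomial (Fin n) K) ∈ supported K (V : Set (Fin n)) :=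
  Subalgebra.sum_mem _ fun _ hi => X_mem_supported.mpr hi

/-- `f` is a form of degree `t` in the variables indexed by `V` whose class modulo
`(x_1^d, …, x_n^d, x^u)` is killed by the power `ℓ^N` of the linear form `ℓ = ∑_{i ∈ V} x_i`,
but not by `ℓ^p`. For `p = 0` and `N = 1` this is a nonzero element of the kernel of `ℓ`. -/
structure IsKernelForm (d : ℕ) (u : Fin n →₀ ℕ) (V : Finset (Fin n)) (t p N : ℕ)
    (f : MvPolynomial (Fin n) K) : Prop where
  isHomogeneous : f.IsHomogeneous t
  mem_supported : f ∈ supported K (V : Set (Fin n))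
  pow_mul_notMem : (∑ i ∈ V, X i) ^ p * f ∉ powersAnd d (monomial u 1)
  pow_mul_mem : (∑ i ∈ V, X i) ^ N * f ∈ powersAnd d (monomial u 1)

variable {V W : Finset (Fin n)} {t r p q N : ℕ} {f g : MvPolynomial (Fin n) K}

namespace IsKernelForm

theorem exists_mem_support (hf : IsKernelForm d u V t p N f) :
    ∃ a ∈ ((∑ i ∈ V, X i) ^ p * f).support,
      IsStandard d u a ∧ a.degree = p + t ∧ (a.support : Set (Fin n)) ⊆ V := by
  obtain ⟨a, ha, hstd⟩ := notMem_powersAnd_monomial.mp hf.pow_mul_notMem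
  have hhom := ((isHomogeneous_sum_X V).pow p).mul hf.isHomogeneous
  rw [one_mul] at hhom
  exact ⟨a, ha, hstd, degree_eq_of_mem_support hhom ha, support_subset_of_mem_supported
    (Subalgebra.mul_mem _ (Subalgebra.pow_mem _ (sum_X_mem_supported V) p) hf.mem_supported) ha⟩

/-- In the geometric sum, only the term with exponents `p` and `q` contributes to the coefficient
at a product of monomials of `x ^ p * f` and `y ^ q * g`. -/
theorem geom_sum_mul_notMem (hf : IsKernelForm d u V t p N f) (hg : IsKernelForm d v W r q N g)
    (hVW : Disjoint V W) (hu : u.support ⊆ V) :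
    (∑ j ∈ Finset.range (p + q + 1),
      (∑ i ∈ V, X i) ^ j * (-∑ i ∈ W, X i) ^ (p + q - j)) * (f * g) ∉
        powersAnd d (monomial u 1) := by
  obtain ⟨a, ha, hastd, hadeg, haV⟩ := hf.exists_mem_support
  obtain ⟨b, hb, hbstd, -, hbW⟩ := hg.exists_mem_support
  have hVW' : Disjoint (V : Set (Fin n)) W := Finset.disjoint_coe.mpr hVW
  refine notMem_powersAnd_monomial.mpr ⟨a + b, ?_,
    IsStandard.add hVW' (Finset.coe_subset.mpr hu) haV hbW hastd hbstd.1⟩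
  have hcoeff (j : ℕ) : coeff (a + b) ((∑ i ∈ V, X i) ^ j * (-∑ i ∈ W, X i) ^ (p + q - j) *
      (f * g)) = coeff a ((∑ i ∈ V, X i) ^ j * f) *
        coeff b ((-∑ i ∈ W, X i) ^ (p + q - j) * g) := by
    rw [mul_mul_mul_comm]
    exact coeff_add_mul_of_disjoint hVW'
      (Subalgebra.mul_mem _ (Subalgebra.pow_mem _ (sum_X_mem_supported V) _) hf.mem_supported)
      (Subalgebra.mul_mem _ (Subalgebra.pow_mem _ (Subalgebra.neg_mem _ (sum_X_mem_supported W)) _)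
        hg.mem_supported) haV hbW
  have hzero (j : ℕ) (hj : j ≠ p) : coeff a ((∑ i ∈ V, X i) ^ j * f) = 0 := by
    refine (((isHomogeneous_sum_X V).pow j).mul hf.isHomogeneous).coeff_eq_zero ?_
    omega
  rw [mem_support_iff, Finset.sum_mul, coeff_sum, Finset.sum_eq_single_of_mem p (by simp)
    fun j _ hj => by rw [hcoeff, hzero j hj, zero_mul], hcoeff, Nat.add_sub_cancel_left]
  refine mul_ne_zero (mem_support_iff.mp ha) ?_
  rw [neg_pow, mul_assoc]
  rcases neg_one_pow_eq_or (MvPolynomial (Fin n) K) q with h | h <;>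
    simpa [h] using mem_support_iff.mp hb

theorem exists_union (hf : IsKernelForm d u V t p (p + q + 1) f)
    (hg : IsKernelForm d v W r q (p + q + 1) g) (hVW : Disjoint V W) (hu : u.support ⊆ V)
    (hv : powersAnd d (monomial v (1 : K)) ≤ powersAnd d (monomial u 1)) :
    ∃ h : MvPolynomial (Fin n) K, IsKernelForm d u (V ∪ W) (p + q + (t + r)) 0 1 h := by
  set x : MvPolynomial (Fin n) K := ∑ i ∈ V, X i
  set y : MvPolynomial (Fin n) K := ∑ i ∈ W, X i
  set s := ∑ j ∈ Finset.range (p + q + 1), x ^ j * (-y) ^ (p + q - j)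
  have hV {z : MvPolynomial (Fin n) K} (hz : z ∈ supported K (V : Set (Fin n))) :
      z ∈ supported K ((V ∪ W : Finset (Fin n)) : Set (Fin n)) :=
    supported_mono (Finset.coe_subset.mpr Finset.subset_union_left) hz
  have hW {z : MvPolynomial (Fin n) K} (hz : z ∈ supported K (W : Set (Fin n))) :
      z ∈ supported K ((V ∪ W : Finset (Fin n)) : Set (Fin n)) :=
    supported_mono (Finset.coe_subset.mpr Finset.subset_union_right) hz
  refine ⟨s * (f * g), ?_, ?_, ?_, ?_⟩
  · refine (IsHomogeneous.sum _ _ _ fun j hj => ?_).mul (hf.isHomogeneous.mul hg.isHomogeneous)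
    have hdeg := ((isHomogeneous_sum_X (K := K) V).pow j).mul
      ((isHomogeneous_sum_X W).neg.pow (p + q - j))
    rwa [one_mul, one_mul, Nat.add_sub_cancel' (Finset.mem_range_succ_iff.mp hj)] at hdeg
  · refine Subalgebra.mul_mem _ (Subalgebra.sum_mem _ fun j _ => ?_)
      (Subalgebra.mul_mem _ (hV hf.mem_supported) (hW hg.mem_supported))
    exact Subalgebra.mul_mem _ (Subalgebra.pow_mem _ (hV (sum_X_mem_supported V)) _)
      (Subalgebra.pow_mem _ (Subalgebra.neg_mem _ (hW (sum_X_mem_supported W))) _)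
  · rw [pow_zero, one_mul]
    exact hf.geom_sum_mul_notMem hg hVW hu
  · have hgeom : s * (x - -y) = x ^ (p + q + 1) - (-y) ^ (p + q + 1) := geom_sum₂_mul _ _ _
    have hsum : (∑ i ∈ V ∪ W, X i) ^ 1 * (s * (f * g)) =
        g * (x ^ (p + q + 1) * f) - (-1) ^ (p + q + 1) * f * (y ^ (p + q + 1) * g) := by
      rw [Finset.sum_union hVW]
      linear_combination f * g * (hgeom - neg_pow y (p + q + 1))
    rw [hsum]
    exact Ideal.sub_mem _ (Ideal.mul_mem_left _ _ hf.pow_mul_mem)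
      (Ideal.mul_mem_left _ _ (hv hg.pow_mul_mem))

theorem singleton (hd : d ≤ u.degree) (hp : p < d) (hN : d ≤ N) (i : Fin n) :
    IsKernelForm d u {i} 0 p N (1 : MvPolynomial (Fin n) K) where
  isHomogeneous := isHomogeneous_one _ _
  mem_supported := Subalgebra.one_mem _
  pow_mul_notMem := by
    rw [Finset.sum_singleton, mul_one]
    exact notMem_powersAnd_of_isHomogeneous (pow_ne_zero p (X_ne_zero i))
      (isHomogeneous_X_pow i p) hp hd
  pow_mul_mem := by
    rw [Finset.sum_singleton, mul_one]
    exact Ideal.pow_mem_of_pow_mem _ (X_pow_mem_powersAnd _ i) hN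

/-- Taking `x_i ^ d` itself as the extra generator leaves just the ideal of `d`-th powers. -/
theorem exists_pair (hd : 0 < d) {i j : Fin n} (hij : i ≠ j) :
    ∃ g : MvPolynomial (Fin n) K, IsKernelForm d (Finsupp.single i d) {i, j} (d - 1) 0 1 g := by
  have hdeg : d ≤ (Finsupp.single i d).degree := (Finsupp.degree_single i d).ge
  have hi := singleton (K := K) (p := d - 1) (N := d - 1 + 0 + 1) hdeg (by omega) (by omega) i
  have hj := singleton (K := K) (p := 0) (N := d - 1 + 0 + 1) hdeg hd (by omega) j
  exact hi.exists_union hj (Finset.disjoint_singleton.mpr hij) Finsupp.support_single_subset le_rfl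

theorem exists_union_pair (hd : 0 < d) (hf : IsKernelForm d u V t 0 1 f) (hu : u.support ⊆ V)
    {i j : Fin n} (hij : i ≠ j) (hV : Disjoint V {i, j}) :
    ∃ h : MvPolynomial (Fin n) K, IsKernelForm d u (V ∪ {i, j}) (t + (d - 1)) 0 1 h := by
  obtain ⟨g, hg⟩ := exists_pair (K := K) hd hij
  have hle : powersAnd d (monomial (Finsupp.single i d) (1 : K)) ≤ powersAnd d (monomial u 1) := by
    rw [powersAnd, Ideal.span_le, Set.union_subset_iff, Set.singleton_subset_iff,
      ← X_pow_eq_monomial]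
    exact ⟨Set.range_subset_iff.mpr (X_pow_mem_powersAnd _), X_pow_mem_powersAnd _ i⟩
  have h := hf.exists_union hg hV hu hle
  rwa [add_zero, zero_add] at h

end IsKernelForm

end KernelForms

section DualForms

variable {K : Type*} [Field K] {n d : ℕ}

/-- The derivation `∑ ∂/∂x_i`, whose kernel consists (in characteristic zero) of the polynomials
invariant under simultaneous translation of the variables. -/
noncomputable def sumDeriv (K : Type*) [Field K] (n : ℕ) :
    Derivation K (MvPolynomial (Fin n) K) (MvPolynomial (Fin n) K) :=
  mkDerivation K fun _ => 1

theorem sumDeriv_eq_sum (F : MvPolynomial (Fin n) K) : sumDeriv K n F = ∑ i, pderiv i F := by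
  have hcoe : ⇑(∑ i, pderiv i : Derivation K (MvPolynomial (Fin n) K) _) = ∑ i, ⇑(pderiv i) :=
    map_sum Derivation.coeFnAddMonoidHom _ _
  have hsum : sumDeriv K n = ∑ i, pderiv i := by
    refine derivation_ext fun j => ?_
    simp [hcoe, sumDeriv, pderiv_X, Pi.single_apply]
  rw [hsum, hcoe, Finset.sum_apply]

theorem sumDeriv_X_sub_X (i j : Fin n) : sumDeriv K n (X i - X j) = 0 := by
  rw [sumDeriv, map_sub, mkDerivation_X, mkDerivation_X, sub_self]

/-- The functional `p ↦ p(∂) F |_{x = 0}`, that is, pairing with `F` by differentiation. -/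
noncomputable def apolarFunctional (F : MvPolynomial (Fin n) K) : MvPolynomial (Fin n) K →ₗ[K] K :=
  (basisMonomials (Fin n) K).constr K fun a => (∏ j, ((a j).factorial : K)) * coeff a F

theorem apolarFunctional_monomial (F : MvPolynomial (Fin n) K) (a : Fin n →₀ ℕ) :
    apolarFunctional F (monomial a 1) = (∏ j, ((a j).factorial : K)) * coeff a F := by
  rw [← congrFun (coe_basisMonomials (Fin n) K) a, apolarFunctional, Module.Basis.constr_basis]

theorem apolarFunctional_eq_zero {F p : MvPolynomial (Fin n) K}
    (h : ∀ a ∈ p.support, coeff a F = 0) : apolarFunctional F p = 0 := by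
  rw [p.as_sum, map_sum]
  refine Finset.sum_eq_zero fun a ha => ?_
  rw [← mul_one (coeff a p), ← smul_eq_mul, ← smul_monomial, map_smul,
    apolarFunctional_monomial, h a ha, mul_zero, smul_zero]

theorem apolarFunctional_X_mul_monomial (F : MvPolynomial (Fin n) K) (i : Fin n) (b : Fin n →₀ ℕ) :
    apolarFunctional F (X i * monomial b 1) = apolarFunctional (pderiv i F) (monomial b 1) := by
  have hprod : ∏ j, (((b + Finsupp.single i 1 : Fin n →₀ ℕ) j).factorial : K) =
      (b i + 1) * ∏ j, ((b j).factorial : K) := by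
    rw [← Finset.mul_prod_erase _ _ (Finset.mem_univ i),
      ← Finset.mul_prod_erase _ (fun j => ((b j).factorial : K)) (Finset.mem_univ i), ← mul_assoc]
    congr 1
    · simp [Nat.factorial_succ]
    · refine Finset.prod_congr rfl fun j hj => ?_
      rw [Finsupp.add_apply, Finsupp.single_eq_of_ne (Finset.ne_of_mem_erase hj), add_zero]
  rw [mul_comm, X, monomial_mul, mul_one, apolarFunctional_monomial, apolarFunctional_monomial,
    coeff_pderiv, hprod]
  ring

theorem apolarFunctional_sum_X_mul {F : MvPolynomial (Fin n) K} (hF : sumDeriv K n F = 0)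
    (p : MvPolynomial (Fin n) K) : apolarFunctional F ((∑ i, X i) * p) = 0 := by
  have h : apolarFunctional F ∘ₗ LinearMap.mulLeft K (∑ i, X i) = 0 := by
    refine (basisMonomials (Fin n) K).ext fun b => ?_
    rw [coe_basisMonomials, LinearMap.comp_apply, LinearMap.mulLeft_apply, LinearMap.zero_apply,
      Finset.sum_mul, map_sum]
    simp only [apolarFunctional_X_mul_monomial, apolarFunctional_monomial]
    rw [← Finset.mul_sum, ← coeff_sum, ← sumDeriv_eq_sum, hF, coeff_zero, mul_zero]
  exact LinearMap.congr_fun h p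

/-- `F` is a nonzero form of degree `t` in the variables indexed by `V`, invariant under
simultaneous translation of the variables; invariance is encoded as vanishing of `sumDeriv`. -/
structure IsInvariantForm (V : Finset (Fin n)) (t : ℕ) (F : MvPolynomial (Fin n) K) : Prop where
  ne_zero : F ≠ 0
  isHomogeneous : F.IsHomogeneous t
  mem_supported : F ∈ supported K (V : Set (Fin n))
  sumDeriv_eq_zero : sumDeriv K n F = 0

variable {V W : Finset (Fin n)} {t r : ℕ} {u : Fin n →₀ ℕ} {F G : MvPolynomial (Fin n) K}

namespace IsInvariantForm

theorem mono (hF : IsInvariantForm V t F) (hVW : V ⊆ W) : IsInvariantForm W t F where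
  __ := hF
  mem_supported := supported_mono (Finset.coe_subset.mpr hVW) hF.mem_supported

theorem mul (hF : IsInvariantForm V t F) (hG : IsInvariantForm V r G) :
    IsInvariantForm V (t + r) (F * G) where
  ne_zero := mul_ne_zero hF.ne_zero hG.ne_zero
  isHomogeneous := hF.isHomogeneous.mul hG.isHomogeneous
  mem_supported := Subalgebra.mul_mem _ hF.mem_supported hG.mem_supported
  sumDeriv_eq_zero := by
    simp [Derivation.leibniz, hF.sumDeriv_eq_zero, hG.sumDeriv_eq_zero]

theorem pow (hF : IsInvariantForm V t F) (k : ℕ) : IsInvariantForm V (t * k) (F ^ k) where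
  ne_zero := pow_ne_zero k hF.ne_zero
  isHomogeneous := hF.isHomogeneous.pow k
  mem_supported := Subalgebra.pow_mem _ hF.mem_supported k
  sumDeriv_eq_zero := by simp [Derivation.leibniz_pow, hF.sumDeriv_eq_zero]

theorem X_sub_X_pow {i j : Fin n} (hi : i ∈ V) (hj : j ∈ V) (hij : i ≠ j) (k : ℕ) :
    IsInvariantForm V k ((X i - X j : MvPolynomial (Fin n) K) ^ k) := by
  have h : IsInvariantForm V 1 (X i - X j : MvPolynomial (Fin n) K) :=
    { ne_zero := sub_ne_zero.mpr fun h => hij (X_injective h)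
      isHomogeneous := (isHomogeneous_X K i).sub (isHomogeneous_X K j)
      mem_supported := Subalgebra.sub_mem _ (X_mem_supported.mpr hi) (X_mem_supported.mpr hj)
      sumDeriv_eq_zero := sumDeriv_X_sub_X i j }
  simpa only [one_mul] using h.pow k

end IsInvariantForm

/-- A translation invariant form all of whose monomials are standard. It obstructs surjectivity of
multiplication by `∑ x_i`, since pairing with it kills the image. -/
structure IsDualForm (d : ℕ) (u : Fin n →₀ ℕ) (V : Finset (Fin n)) (t : ℕ)
    (F : MvPolynomial (Fin n) K) : Prop extends IsInvariantForm V t F where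
  isStandard : ∀ a ∈ F.support, IsStandard d u a

namespace IsDualForm

theorem exists_notMem [CharZero K] (hF : IsDualForm d u V t F) :
    ∃ q : MvPolynomial (Fin n) K, q.IsHomogeneous t ∧
      q ∉ Ideal.span {∑ j, X j} ⊔ powersAnd d (monomial u 1) := by
  obtain ⟨a, ha⟩ := support_nonempty.mpr hF.ne_zero
  refine ⟨monomial a 1, isHomogeneous_monomial _ (degree_eq_of_mem_support hF.isHomogeneous ha),
    fun h => ?_⟩
  obtain ⟨s, p, hp, hsum⟩ := Ideal.mem_span_singleton_sup.mp h
  have hp₀ : apolarFunctional F p = 0 := apolarFunctional_eq_zero fun b hb =>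
    notMem_support_iff.mp fun hbF => mem_powersAnd_monomial.mp hp b hb (hF.isStandard b hbF)
  have hcoeff : (∏ j, ((a j).factorial : K)) * coeff a F = 0 := by
    rw [← apolarFunctional_monomial, ← hsum, map_add, hp₀, mul_comm s,
      apolarFunctional_sum_X_mul hF.sumDeriv_eq_zero, add_zero]
  refine mul_ne_zero (Finset.prod_ne_zero_iff.mpr fun j _ => ?_) (mem_support_iff.mp ha) hcoeff
  exact Nat.cast_ne_zero.mpr (Nat.factorial_ne_zero _)

theorem mul (hF : IsDualForm d u V t F) (hG : IsInvariantForm W r G) (hu : u.support ⊆ V)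
    (hVW : Disjoint V W) (hGd : ∀ a ∈ G.support, ∀ i, a i < d) :
    IsDualForm d u (V ∪ W) (t + r) (F * G) where
  __ := (hF.mono Finset.subset_union_left).mul (hG.mono Finset.subset_union_right)
  isStandard a ha := by
    classical
    obtain ⟨b, hb, c, hc, rfl⟩ := Finset.mem_add.mp (support_mul F G ha)
    exact (hF.isStandard b hb).add (Finset.disjoint_coe.mpr hVW) (Finset.coe_subset.mpr hu)
      (support_subset_of_mem_supported hF.mem_supported hb)
      (support_subset_of_mem_supported hG.mem_supported hc) (hGd c hc)

theorem mul_X_sub_X_pow (hd : 0 < d) (hF : IsDualForm d u V t F) (hu : u.support ⊆ V)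
    {i j : Fin n} (hij : i ≠ j) (hV : Disjoint V {i, j}) :
    IsDualForm d u (V ∪ {i, j}) (t + (d - 1)) (F * (X i - X j) ^ (d - 1)) := by
  have hG : IsInvariantForm {i, j} (d - 1) ((X i - X j : MvPolynomial (Fin n) K) ^ (d - 1)) :=
    .X_sub_X_pow (by simp) (by simp) hij _
  refine hF.mul hG hu hV fun a ha l => (Finsupp.le_degree l a).trans_lt ?_
  rw [degree_eq_of_mem_support hG.isHomogeneous ha]
  omega

end IsDualForm

end DualForms

theorem failsWLPInDegree_of_forms {K : Type*} [Field K] [CharZero K] {n d t : ℕ} {u : Fin n →₀ ℕ}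
    {V : Finset (Fin n)} {f F : MvPolynomial (Fin n) K} (hd : 0 < d) (hu : u.support ⊆ V)
    (hf : IsKernelForm d u V t 0 1 f) (hF : IsDualForm d u V (t + 1) F) (r : ℕ)
    (hn : n = V.card + 2 * r) :
    FailsWLPInDegree (powersAnd d (monomial u (1 : K))) (t + r * (d - 1)) := by
  induction r generalizing V t f F with
  | zero =>
    obtain rfl : V = Finset.univ := Finset.card_eq_iff_eq_univ V |>.mp (by simpa using hn.symm)
    obtain ⟨q, hq, hqI⟩ := hF.exists_notMem
    rw [zero_mul, add_zero]
    refine failsWLPInDegree_of_sum_X powersAnd_monomial_le_comap_rescale hf.isHomogeneous ?_ ?_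
      hq hqI
    · simpa using hf.pow_mul_notMem
    · simpa using hf.pow_mul_mem
  | succ r ih =>
    have hcard : 1 < Vᶜ.card := by
      rw [Finset.card_compl, Fintype.card_fin]
      omega
    obtain ⟨i, hi, j, hj, hij⟩ := Finset.one_lt_card.mp hcard
    have hV : Disjoint V {i, j} := by simp_all
    obtain ⟨h, hh⟩ := hf.exists_union_pair hd hu hij hV
    have hH := hF.mul_X_sub_X_pow hd hu hij hV
    rw [add_right_comm] at hH
    have hfails := ih (hu.trans Finset.subset_union_left) hh hH (by
      rw [Finset.card_union_of_disjoint hV, Finset.card_pair hij]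
      omega)
    rwa [add_assoc, add_comm (d - 1), ← Nat.succ_mul] at hfails

section Differences

variable {K : Type*} [Field K] {n : ℕ} {V : Finset (Fin n)}

theorem degreeOf_X_sub_X_pow_le (l i j : Fin n) (k : ℕ) :
    ((X i - X j : MvPolynomial (Fin n) K) ^ k).degreeOf l ≤ if l = i ∨ l = j then k else 0 := by
  have h : (X i - X j : MvPolynomial (Fin n) K).degreeOf l ≤ if l = i ∨ l = j then 1 else 0 := by
    refine (degreeOf_sub_le l _ _).trans ?_
    rw [degreeOf_X, degreeOf_X]
    split_ifs <;> simp_all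
  refine (degreeOf_pow_le l _ k).trans ((Nat.mul_le_mul_left k h).trans ?_)
  split_ifs <;> simp

theorem isInvariantForm_triangle {a b c : Fin n} (ha : a ∈ V) (hb : b ∈ V) (hc : c ∈ V)
    (hab : a ≠ b) (hac : a ≠ c) (hbc : b ≠ c) (h k : ℕ) :
    IsInvariantForm V (h + h + k) ((X a - X b : MvPolynomial (Fin n) K) ^ h * (X a - X c) ^ h *
      (X b - X c) ^ k) :=
  ((IsInvariantForm.X_sub_X_pow ha hb hab h).mul (.X_sub_X_pow ha hc hac h)).mul
    (.X_sub_X_pow hb hc hbc k)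

theorem degreeOf_triangle_le {a b c : Fin n} (hab : a ≠ b) (hac : a ≠ c) (hbc : b ≠ c) {h k : ℕ}
    (hk : h ≤ k) (l : Fin n) : ((X a - X b : MvPolynomial (Fin n) K) ^ h * (X a - X c) ^ h *
      (X b - X c) ^ k).degreeOf l ≤ h + k := by
  refine (degreeOf_mul_le _ _ _).trans ((add_le_add ((degreeOf_mul_le _ _ _).trans
    (add_le_add (degreeOf_X_sub_X_pow_le l a b h) (degreeOf_X_sub_X_pow_le l a c h)))
    (degreeOf_X_sub_X_pow_le l b c k)).trans ?_)
  split_ifs with hlab hlac hlbc <;> omega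

end Differences

section SquarefreeMonomials

variable {n k : ℕ}

/-- The exponent vector of the squarefree monomial `∏ i, x_{x i}`. -/
noncomputable def squarefreeExponent (x : Fin k ↪ Fin n) : Fin n →₀ ℕ :=
  ∑ i, Finsupp.single (x i) 1

theorem monomial_squarefreeExponent {K : Type*} [Field K] (x : Fin k ↪ Fin n) :
    monomial (squarefreeExponent x) (1 : K) = ∏ i, X (x i) :=
  monomial_sum_one _ _

theorem degree_squarefreeExponent (x : Fin k ↪ Fin n) : (squarefreeExponent x).degree = k := by
  simp [squarefreeExponent]

theorem squarefreeExponent_apply (x : Fin k ↪ Fin n) (i : Fin k) :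
    squarefreeExponent x (x i) = 1 := by
  simp [squarefreeExponent, Finsupp.finsetSum_apply, Finsupp.single_apply]

theorem support_squarefreeExponent_subset (x : Fin k ↪ Fin n) :
    (squarefreeExponent x).support ⊆ Finset.univ.map x := by
  refine Finsupp.support_finsetSum.trans (Finset.biUnion_subset.mpr fun i _ => ?_)
  exact Finsupp.support_single_subset.trans (by simp)

end SquarefreeMonomials

section MixedForm

variable {R : Type*} [CommRing R]

/-- The second derivative `∂²/∂y∂z` of the complete homogeneous form of degree `n + 2`, used as the
form of degree `n` that `(y - z) ^ 3` multiplies into the ideal `(y ^ (n + 2), z ^ (n + 2))`. -/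
def mixedForm (n : ℕ) (y z : R) : R :=
  ∑ p ∈ Finset.HasAntidiagonal.antidiagonal n, (p.1 + 1 : R) * (p.2 + 1) * (y ^ p.1 * z ^ p.2)

theorem sub_sq_mul_sum_antidiagonal (n : ℕ) (y z : R) :
    (y - z) ^ 2 * ∑ p ∈ Finset.HasAntidiagonal.antidiagonal n, (p.1 + 1 : R) * (y ^ p.1 * z ^ p.2) =
      (n + 1) * y ^ (n + 2) - (n + 2) * y ^ (n + 1) * z + z ^ (n + 2) := by
  induction n with
  | zero => simp; ring
  | succ n ih =>
    have hstep (p : ℕ × ℕ) : (p.1 + 1 : R) * (y ^ p.1 * z ^ (p.2 + 1)) =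
        z * ((p.1 + 1) * (y ^ p.1 * z ^ p.2)) := by ring
    simp only [Finset.Nat.sum_antidiagonal_succ', hstep, ← Finset.mul_sum]
    push_cast
    linear_combination z * ih

theorem sub_pow_three_mul_mixedForm (n : ℕ) (y z : R) :
    (y - z) ^ 3 * mixedForm n y z = ((n + 1) * y - (n + 3) * z) * y ^ (n + 2) -
      ((n + 1) * z - (n + 3) * y) * z ^ (n + 2) := by
  induction n with
  | zero => simp [mixedForm]; ring
  | succ n ih =>
    have hstep (p : ℕ × ℕ) :
        (p.1 + 1 : R) * ((p.2 + 1 : ℕ) + 1) * (y ^ p.1 * z ^ (p.2 + 1)) =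
          z * ((p.1 + 1) * (p.2 + 1) * (y ^ p.1 * z ^ p.2)) +
            z * ((p.1 + 1) * (y ^ p.1 * z ^ p.2)) := by
      push_cast
      ring
    rw [mixedForm] at ih ⊢
    simp only [Finset.Nat.sum_antidiagonal_succ', hstep, Finset.sum_add_distrib, ← Finset.mul_sum]
    push_cast
    linear_combination z * ih + z * (y - z) * sub_sq_mul_sum_antidiagonal n y z

end MixedForm

section TwoVariableMonomial

variable {K : Type*} [Field K] {n d a b p N : ℕ} {i j k : Fin n}

theorem monomial_single_add_single (i j : Fin n) (a b : ℕ) :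
    monomial (Finsupp.single i a + Finsupp.single j b) (1 : K) = X i ^ a * X j ^ b := by
  rw [X_pow_eq_monomial, X_pow_eq_monomial, monomial_mul, mul_one]

theorem coeff_X_add_X_pow (hij : i ≠ j) (a b : ℕ) :
    coeff (Finsupp.single i a + Finsupp.single j b)
      ((X i + X j : MvPolynomial (Fin n) K) ^ (a + b)) = ((a + b).choose a : K) := by
  rw [add_pow, coeff_sum, Finset.sum_eq_single_of_mem a (by simp)]
  · rw [← monomial_single_add_single, Nat.add_sub_cancel_left, ← nsmul_eq_mul', coeff_smul,
      coeff_monomial, if_pos rfl, nsmul_one]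
  · intro m _ hm
    rw [← monomial_single_add_single, ← nsmul_eq_mul', coeff_smul, coeff_monomial, if_neg,
      nsmul_zero]
    intro h
    exact hm (by simpa [hij] using DFunLike.congr_fun h i)

theorem isKernelForm_pair [CharZero K] (hij : i ≠ j) (hb : b ≤ a) (ha : 0 < a) (had : a ≤ d)
    (hp : p + 2 = d + a) (hN : d + a ≤ N + 1) :
    IsKernelForm d (Finsupp.single i a + Finsupp.single j b) {i, j} 0 p N
      (1 : MvPolynomial (Fin n) K) where
  isHomogeneous := isHomogeneous_one _ _
  mem_supported := Subalgebra.one_mem _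
  pow_mul_notMem := by
    refine notMem_powersAnd_monomial.mpr ⟨Finsupp.single i (a - 1) + Finsupp.single j (d - 1),
      ?_, fun l => ?_, fun h => ?_⟩
    · obtain rfl : p = a - 1 + (d - 1) := by omega
      rw [Finset.sum_pair hij, mul_one, mem_support_iff, coeff_X_add_X_pow hij]
      exact Nat.cast_ne_zero.mpr (Nat.choose_ne_zero (Nat.le_add_right _ _))
    · by_cases hli : l = i <;> by_cases hlj : l = j <;>
        simp_all [Finsupp.single_apply, eq_comm] <;> omega
    · have := h i
      simp [hij] at this
      omega
  pow_mul_mem := by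
    rw [Finset.sum_pair hij, mul_one, add_pow]
    refine Ideal.sum_mem _ fun m _ => Ideal.mul_mem_right _ _ ?_
    by_cases hm : d ≤ m
    · exact Ideal.mul_mem_right _ _ (Ideal.pow_mem_of_pow_mem _ (X_pow_mem_powersAnd _ i) hm)
    by_cases hm' : d ≤ N - m
    · exact Ideal.mul_mem_left _ _ (Ideal.pow_mem_of_pow_mem _ (X_pow_mem_powersAnd _ j) hm')
    have hu := self_mem_powersAnd (d := d)
      (monomial (Finsupp.single i a + Finsupp.single j b) (1 : K))
    rw [monomial_single_add_single] at hu ⊢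
    exact Ideal.mem_of_dvd _ (mul_dvd_mul (pow_dvd_pow _ (by omega)) (pow_dvd_pow _ (by omega))) hu

theorem isHomogeneous_mixedForm (i j : Fin n) (t : ℕ) :
    (mixedForm t (X i) (-X j) : MvPolynomial (Fin n) K).IsHomogeneous t := by
  refine IsHomogeneous.sum _ _ _ fun p hp => ?_
  have h := ((isHomogeneous_X K i).pow p.1).mul ((isHomogeneous_X K j).neg.pow p.2)
  rw [one_mul, one_mul, Finset.HasAntidiagonal.mem_antidiagonal.mp hp] at h
  have hC := (isHomogeneous_C (Fin n) ((p.1 + 1 : K) * (p.2 + 1))).mul h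
  simpa using hC

theorem mixedForm_ne_zero [CharZero K] (hij : i ≠ j) (t : ℕ) :
    (mixedForm t (X i) (-X j) : MvPolynomial (Fin n) K) ≠ 0 := fun h => by
  have hzero := congrArg (eval (Pi.single i (1 : K))) h
  cases t
  · simp [mixedForm] at hzero
  rw [mixedForm, Finset.Nat.sum_antidiagonal_succ'] at hzero
  simp [hij.symm] at hzero
  norm_cast at hzero

theorem mixedForm_mem_supported {V : Set (Fin n)} (hi : i ∈ V) (hj : j ∈ V) (t : ℕ) :
    (mixedForm t (X i) (-X j) : MvPolynomial (Fin n) K) ∈ supported K V := by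
  have hX : (X i : MvPolynomial (Fin n) K) ∈ supported K V := X_mem_supported.mpr hi
  have hY : (-X j : MvPolynomial (Fin n) K) ∈ supported K V := neg_mem (X_mem_supported.mpr hj)
  refine sum_mem fun p _ => mul_mem ?_ (mul_mem (pow_mem hX _) (pow_mem hY _))
  exact_mod_cast natCast_mem (supported K V) ((p.1 + 1) * (p.2 + 1))

theorem isKernelForm_triple [CharZero K] {u : Fin n →₀ ℕ} (hd : 2 ≤ d) (hu : d ≤ u.degree)
    (hij : i ≠ j) (hik : i ≠ k) (hjk : j ≠ k) (hN : d + 2 ≤ N) :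
    IsKernelForm d u {i, j, k} (d - 2) 0 N
      (mixedForm (d - 2) (X i) (-X j) : MvPolynomial (Fin n) K) := by
  refine ⟨isHomogeneous_mixedForm i j _, mixedForm_mem_supported (by simp) (by simp) _, ?_, ?_⟩
  · rw [pow_zero, one_mul]
    exact notMem_powersAnd_of_isHomogeneous (mixedForm_ne_zero hij _)
      (isHomogeneous_mixedForm i j _) (by omega) hu
  obtain ⟨m, rfl⟩ := Nat.exists_eq_add_of_le' hd
  rw [Nat.add_sub_cancel]
  set I := powersAnd (m + 2) (monomial u (1 : K))
  set g : MvPolynomial (Fin n) K := mixedForm m (X i) (-X j)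
  have hi : X i ^ (m + 2) ∈ I := X_pow_mem_powersAnd _ i
  have hj : (-X j) ^ (m + 2) ∈ I := by
    rw [neg_pow]
    exact Ideal.mul_mem_left _ _ (X_pow_mem_powersAnd _ j)
  have hpair : (X i + X j) ^ 3 ∈ I.colon {g} := by
    rw [Submodule.mem_colon_singleton, smul_eq_mul, ← sub_neg_eq_add,
      sub_pow_three_mul_mixedForm]
    exact sub_mem (Ideal.mul_mem_left _ _ hi) (Ideal.mul_mem_left _ _ hj)
  have hsingle : X k ^ (m + 2) ∈ I.colon {g} := by
    rw [Submodule.mem_colon_singleton, smul_eq_mul]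
    exact Ideal.mul_mem_right _ _ (X_pow_mem_powersAnd _ k)
  rw [Finset.sum_insert (by simp [hij, hik]), Finset.sum_pair hjk, ← add_assoc, ← smul_eq_mul,
    ← Submodule.mem_colon_singleton]
  exact Ideal.add_pow_mem_of_pow_mem_of_le _ hpair hsingle (by omega)

theorem isDualForm_five (x : Fin 5 ↪ Fin n) {u : Fin n →₀ ℕ} (hd : 0 < d) (hu : d ≤ u.degree)
    (hux : u.support ⊆ {x 0, x 1}) :
    IsDualForm (K := K) d u ({x 0, x 1} ∪ {x 2, x 3, x 4}) (2 * (d - 1) + (d - 1) / 2)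
      ((X (x 0) - X (x 1)) ^ (d - 1) * ((X (x 2) - X (x 3)) ^ ((d - 1) / 2) *
        (X (x 2) - X (x 4)) ^ ((d - 1) / 2) * (X (x 3) - X (x 4)) ^ (d - 1 - (d - 1) / 2))) := by
  have hpair : IsDualForm (K := K) d u {x 0, x 1} (d - 1) ((X (x 0) - X (x 1)) ^ (d - 1)) := by
    refine ⟨.X_sub_X_pow (by simp) (by simp) (by simp) _, fun a ha => ?_⟩
    have hdeg := degree_eq_of_mem_support
      (((isHomogeneous_X K _).sub (isHomogeneous_X K _)).pow _) ha
    exact isStandard_of_degree_lt (by omega) hu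
  have htriangle := isInvariantForm_triangle (K := K) (V := {x 2, x 3, x 4}) (a := x 2) (b := x 3)
    (c := x 4) (by simp) (by simp) (by simp) (by simp) (by simp) (by simp) ((d - 1) / 2)
    (d - 1 - (d - 1) / 2)
  have hdeg : 2 * (d - 1) + (d - 1) / 2 =
      d - 1 + ((d - 1) / 2 + (d - 1) / 2 + (d - 1 - (d - 1) / 2)) := by omega
  rw [hdeg]
  refine hpair.mul htriangle hux (by simp) fun a ha l => ?_
  have hl := (monomial_le_degreeOf l ha).trans
    (degreeOf_triangle_le (by simp) (by simp) (by simp) (by omega) l)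
  omega

theorem failsWLPInDegree_of_two_variable_monomial [CharZero K] (hd : 5 ≤ d) (x : Fin 5 ↪ Fin n)
    {r : ℕ} (hn : n = 5 + 2 * r) :
    FailsWLPInDegree (powersAnd d
      (X (x 0) ^ ((d + 1) / 2) * X (x 1) ^ (d / 2) : MvPolynomial (Fin n) K))
        (2 * (d - 2) + (d + 1) / 2 + r * (d - 1)) := by
  rw [← monomial_single_add_single]
  set u := Finsupp.single (x 0) ((d + 1) / 2) + Finsupp.single (x 1) (d / 2) with hu
  have hdeg : d ≤ u.degree := by
    rw [hu, map_add, Finsupp.degree_single, Finsupp.degree_single]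
    omega
  have hsupp : u.support ⊆ {x 0, x 1} := Finsupp.support_add.trans
    (Finset.union_subset_union Finsupp.support_single_subset Finsupp.support_single_subset)
  have hdisj : Disjoint ({x 0, x 1} : Finset (Fin n)) {x 2, x 3, x 4} := by simp
  have hf : IsKernelForm d u {x 0, x 1} 0 (d + (d + 1) / 2 - 2) (d + (d + 1) / 2 - 2 + 0 + 1)
      (1 : MvPolynomial (Fin n) K) :=
    isKernelForm_pair (by simp) (by omega) (by omega) (by omega) (by omega) (by omega)
  have hg := isKernelForm_triple (K := K) (N := d + (d + 1) / 2 - 2 + 0 + 1) (i := x 2) (j := x 3)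
    (k := x 4) (by omega) hdeg (by simp) (by simp) (by simp) (by omega)
  obtain ⟨h, hh⟩ := hf.exists_union hg hdisj hsupp le_rfl
  have hF := isDualForm_five (K := K) x (by omega) hdeg hsupp
  have ht : d + (d + 1) / 2 - 2 + 0 + (0 + (d - 2)) = 2 * (d - 2) + (d + 1) / 2 := by omega
  have ht' : 2 * (d - 1) + (d - 1) / 2 = 2 * (d - 2) + (d + 1) / 2 + 1 := by omega
  rw [ht] at hh
  rw [ht'] at hF
  refine failsWLPInDegree_of_forms (by omega) (hsupp.trans Finset.subset_union_left) hh hF r ?_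
  have hcard : ({x 0, x 1} ∪ {x 2, x 3, x 4} : Finset (Fin n)).card = 5 := by
    rw [Finset.card_union_of_disjoint hdisj]
    simp
  rwa [hcard]

end TwoVariableMonomial

section FourthPowers

theorem sum_pow_four_mul_mem {R : Type*} [CommRing R] {I : Ideal R} {a b c e : R}
    (ha : a ^ 4 ∈ I) (hb : b ^ 4 ∈ I) (hc : c ^ 4 ∈ I) (he : e ^ 4 ∈ I)
    (habce : a * b * c * e ∈ I) :
    (a + b + c + e) ^ 4 * (4 * (a + b + c + e) ^ 3 -
      21 * (a + b + c + e) * (a ^ 2 + b ^ 2 + c ^ 2 + e ^ 2) +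
        35 * (a ^ 3 + b ^ 3 + c ^ 3 + e ^ 3)) ∈ I := by
  -- The coefficients of the cubic and of the certificate solve a linear system.
  set e₁ := a + b + c + e with he₁
  set e₂ := a * b + a * c + a * e + b * c + b * e + c * e with he₂
  set e₃ := a * b * c + a * b * e + a * c * e + b * c * e with he₃
  let q (z : R) := 105 * e₁ * e₂ - 45 * e₃ - (42 * e₁ ^ 2 + 18 * e₂) * z + 60 * e₁ * z ^ 2
  have hcert : e₁ ^ 4 * (4 * e₁ ^ 3 - 21 * e₁ * (a ^ 2 + b ^ 2 + c ^ 2 + e ^ 2) +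
      35 * (a ^ 3 + b ^ 3 + c ^ 3 + e ^ 3)) = q a * a ^ 4 + q b * b ^ 4 + q c * c ^ 4 +
        q e * e ^ 4 + (150 * e₁ ^ 3 - 30 * e₁ * e₂ - 180 * e₃) * (a * b * c * e) := by
    simp only [q, he₁, he₂, he₃]
    ring
  rw [hcert]
  exact add_mem (add_mem (add_mem (add_mem (I.mul_mem_left _ ha) (I.mul_mem_left _ hb))
    (I.mul_mem_left _ hc)) (I.mul_mem_left _ he)) (I.mul_mem_left _ habce)

variable {K : Type*} [Field K] {n : ℕ}

theorem isKernelForm_fourthPowers [CharZero K] (y : Fin 4 ↪ Fin n) :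
    IsKernelForm (K := K) 4 (squarefreeExponent y) (Finset.univ.map y) 3 0 4
      (4 * (∑ i, X (y i)) ^ 3 - 21 * (∑ i, X (y i)) * ∑ i, X (y i) ^ 2 +
        35 * ∑ i, X (y i) ^ 3) := by
  set f : MvPolynomial (Fin n) K := 4 * (∑ i, X (y i)) ^ 3 -
    21 * (∑ i, X (y i)) * ∑ i, X (y i) ^ 2 + 35 * ∑ i, X (y i) ^ 3 with hf
  have hhom : f.IsHomogeneous 3 := by
    have hconst (c : K) : (C c : MvPolynomial (Fin n) K).IsHomogeneous 0 := isHomogeneous_C _ c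
    have hsum (k : ℕ) : (∑ i, X (y i) ^ k : MvPolynomial (Fin n) K).IsHomogeneous k :=
      .sum _ _ _ fun i _ => isHomogeneous_X_pow _ k
    have hsum₁ : (∑ i, X (y i) : MvPolynomial (Fin n) K).IsHomogeneous 1 := by simpa using hsum 1
    exact (((hconst 4).mul (hsum₁.pow 3)).sub (((hconst 21).mul hsum₁).mul (hsum 2))).add
      ((hconst 35).mul (hsum 3))
  have hsupp : f ∈ supported K (Finset.univ.map y : Set (Fin n)) := by
    have hX (i : Fin 4) : (X (y i) : MvPolynomial (Fin n) K) ∈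
      supported K (Finset.univ.map y : Set (Fin n)) := X_mem_supported.mpr (by simp)
    exact add_mem (sub_mem (mul_mem (ofNat_mem _ 4) (pow_mem (sum_mem fun i _ => hX i) 3))
      (mul_mem (mul_mem (ofNat_mem _ 21) (sum_mem fun i _ => hX i))
        (sum_mem fun i _ => pow_mem (hX i) 2)))
      (mul_mem (ofNat_mem _ 35) (sum_mem fun i _ => pow_mem (hX i) 3))
  have hne : f ≠ 0 := fun h => by
    have h₁ := congrArg (eval (Pi.single (y 0) (1 : K))) h
    simp [hf, Fin.sum_univ_four] at h₁
    norm_num at h₁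
  refine ⟨hhom, hsupp, ?_, ?_⟩
  · rw [pow_zero, one_mul]
    exact notMem_powersAnd_of_isHomogeneous hne hhom (by norm_num) (degree_squarefreeExponent y).ge
  · have hu := self_mem_powersAnd (d := 4) (monomial (squarefreeExponent y) (1 : K))
    rw [monomial_squarefreeExponent, Fin.prod_univ_four] at hu ⊢
    simp only [hf, Finset.sum_map, Fin.sum_univ_four]
    exact sum_pow_four_mul_mem (X_pow_mem_powersAnd _ _) (X_pow_mem_powersAnd _ _)
      (X_pow_mem_powersAnd _ _) (X_pow_mem_powersAnd _ _) hu

/-- The second factor of the dual form for fourth powers: multilinear and translation invariant. -/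
noncomputable def cyclicQuadric (K : Type*) [Field K] (x : Fin 5 ↪ Fin n) :
    MvPolynomial (Fin n) K :=
  (X (x 0) - X (x 3)) * (X (x 1) - X (x 4)) + (X (x 1) - X (x 3)) * (X (x 2) - X (x 4)) +
    (X (x 2) - X (x 3)) * (X (x 0) - X (x 4))

theorem isInvariantForm_cyclicQuadric [CharZero K] (x : Fin 5 ↪ Fin n) :
    IsInvariantForm (Finset.univ.map x) 2 (cyclicQuadric K x) := by
  have hmul (i j k l : Fin 5) (hij : i ≠ j) (hkl : k ≠ l) :
      IsInvariantForm (K := K) (Finset.univ.map x) 2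
        ((X (x i) - X (x j)) * (X (x k) - X (x l))) := by
    simpa only [pow_one] using
      (IsInvariantForm.X_sub_X_pow (K := K) (V := Finset.univ.map x) (by simp) (by simp)
        (x.injective.ne hij) 1).mul (.X_sub_X_pow (by simp) (by simp) (x.injective.ne hkl) 1)
  have h₁ := hmul 0 3 1 4 (by decide) (by decide)
  have h₂ := hmul 1 3 2 4 (by decide) (by decide)
  have h₃ := hmul 2 3 0 4 (by decide) (by decide)
  refine ⟨fun h => ?_, (h₁.isHomogeneous.add h₂.isHomogeneous).add h₃.isHomogeneous,
    add_mem (add_mem h₁.mem_supported h₂.mem_supported) h₃.mem_supported, ?_⟩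
  · have hzero := congrArg (eval fun i => if i = x 3 ∨ i = x 4 then (0 : K) else 1) h
    simp [cyclicQuadric] at hzero
    norm_num at hzero
  · rw [cyclicQuadric, map_add, map_add, h₁.sumDeriv_eq_zero, h₂.sumDeriv_eq_zero,
      h₃.sumDeriv_eq_zero, add_zero, add_zero]

theorem degreeOf_cyclicQuadric_le (x : Fin 5 ↪ Fin n) (l : Fin n) :
    (cyclicQuadric K x).degreeOf l ≤ 1 := by
  have hprod (i j k m : Fin 5) (hik : i ≠ k) (him : i ≠ m) (hjk : j ≠ k) (hjm : j ≠ m) :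
      degreeOf l ((X (x i) - X (x j)) * (X (x k) - X (x m)) : MvPolynomial (Fin n) K) ≤ 1 := by
    have h := (degreeOf_mul_le l _ _).trans (add_le_add
      (degreeOf_X_sub_X_pow_le (K := K) l (x i) (x j) 1)
      (degreeOf_X_sub_X_pow_le (K := K) l (x k) (x m) 1))
    rw [pow_one, pow_one] at h
    refine h.trans ?_
    have := x.injective.ne hik
    have := x.injective.ne him
    have := x.injective.ne hjk
    have := x.injective.ne hjm
    split_ifs <;> omega
  refine (degreeOf_add_le _ _ _).trans (max_le ((degreeOf_add_le _ _ _).trans (max_le ?_ ?_)) ?_)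
  all_goals exact hprod _ _ _ _ (by decide) (by decide) (by decide) (by decide)

/-- The degree seven dual form for fourth powers and a product of four variables. -/
noncomputable def septicForm (K : Type*) [Field K] (x : Fin 5 ↪ Fin n) :
    MvPolynomial (Fin n) K :=
  (X (x 0) - X (x 1)) ^ 1 * (X (x 0) - X (x 2)) ^ 1 * (X (x 1) - X (x 2)) ^ 1 *
    (X (x 3) - X (x 4)) ^ 2 * cyclicQuadric K x

theorem isInvariantForm_septicForm [CharZero K] (x : Fin 5 ↪ Fin n) :
    IsInvariantForm (Finset.univ.map x) 7 (septicForm K x) :=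
  ((isInvariantForm_triangle (by simp) (by simp) (by simp) (by simp) (by simp) (by simp) 1 1).mul
    (.X_sub_X_pow (by simp) (by simp) (by simp) 2)).mul (isInvariantForm_cyclicQuadric x)

theorem degreeOf_septicForm_le (x : Fin 5 ↪ Fin n) (l : Fin n) :
    (septicForm K x).degreeOf l ≤ 3 := by
  have hdiff := degreeOf_X_sub_X_pow_le (K := K) l
  have h := (degreeOf_mul_le l _ _).trans (add_le_add ((degreeOf_mul_le l _ _).trans
    (add_le_add ((degreeOf_mul_le l _ _).trans (add_le_add ((degreeOf_mul_le l _ _).trans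
      (add_le_add (hdiff (x 0) (x 1) 1) (hdiff (x 0) (x 2) 1))) (hdiff (x 1) (x 2) 1)))
        (hdiff (x 3) (x 4) 2))) (degreeOf_cyclicQuadric_le (K := K) x l))
  refine h.trans ?_
  by_cases hl : l = x 3 ∨ l = x 4
  · rcases hl with rfl | rfl <;> simp
  · rw [if_neg hl]
    have h01 : x 0 ≠ x 1 := by simp
    have h02 : x 0 ≠ x 2 := by simp
    have h12 : x 1 ≠ x 2 := by simp
    split_ifs <;> omega

theorem septicForm_mem_restrictSupport (x : Fin 5 ↪ Fin n) {u : Fin n →₀ ℕ}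
    (hu : ∀ i ∈ ({0, 1, 2} : Finset (Fin 5)), u (x i) ≠ 0) :
    septicForm K x ∈ restrictSupport K {a | ¬ u ≤ a} := by
  let T (i j : Fin 5) : MvPolynomial (Fin n) K :=
    X (x i) * X (x j) * (X (x i) - X (x j)) * (X (x 3) - X (x 4)) ^ 2 *
      (X (x i) * X (x j) - (X (x 3) + X (x 4)) * (X (x i) + X (x j)) + 3 * (X (x 3) * X (x 4)))
  have hT (i j k : Fin 5) (hk : k ∈ ({0, 1, 2} : Finset (Fin 5))) (hki : k ≠ i) (hkj : k ≠ j) :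
      T i j ∈ restrictSupport K {a | ¬ u ≤ a} := by
    have hX {l : Fin 5} (hl : l = i ∨ l = j ∨ l = 3 ∨ l = 4) :
        (X (x l) : MvPolynomial (Fin n) K) ∈ supported K {x i, x j, x 3, x 4} :=
      X_mem_supported.mpr (by simpa using hl)
    have hi := hX (l := i) (by simp)
    have hj := hX (l := j) (by simp)
    have h3 := hX (l := 3) (by simp)
    have h4 := hX (l := 4) (by simp)
    refine mem_restrictSupport_of_mem_supported (V := {x i, x j, x 3, x 4}) ?_ (i := x k) ?_
      (hu k hk)
    · exact mul_mem (mul_mem (mul_mem (mul_mem hi hj) (sub_mem hi hj)) (pow_mem (sub_mem h3 h4) 2))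
        (add_mem (sub_mem (mul_mem hi hj) (mul_mem (add_mem h3 h4) (add_mem hi hj)))
          (mul_mem (ofNat_mem _ 3) (mul_mem h3 h4)))
    · fin_cases hk <;> simp_all
  have hexpand : septicForm K x = T 0 1 - T 0 2 + T 1 2 := by
    simp only [septicForm, cyclicQuadric, T]
    ring
  rw [hexpand]
  exact add_mem (sub_mem (hT 0 1 2 (by decide) (by decide) (by decide))
    (hT 0 2 1 (by decide) (by decide) (by decide))) (hT 1 2 0 (by decide) (by decide) (by decide))

theorem isDualForm_septicForm [CharZero K] (x : Fin 5 ↪ Fin n) :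
    IsDualForm 4 (squarefreeExponent (Fin.castSuccEmb.trans x)) (Finset.univ.map x) 7
      (septicForm K x) where
  __ := isInvariantForm_septicForm x
  isStandard a ha := by
    refine ⟨fun l => ((monomial_le_degreeOf l ha).trans (degreeOf_septicForm_le x l)).trans_lt
      (by norm_num), (mem_restrictSupport_iff K).mp (septicForm_mem_restrictSupport x ?_) ha⟩
    intro i hi
    obtain ⟨j, rfl⟩ : ∃ j : Fin 4, j.castSucc = i := by
      fin_cases hi
      exacts [⟨0, rfl⟩, ⟨1, rfl⟩, ⟨2, rfl⟩]
    exact (squarefreeExponent_apply (Fin.castSuccEmb.trans x) j).trans_ne one_ne_zero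

theorem failsWLPInDegree_fourthPowers [CharZero K] (x : Fin 5 ↪ Fin n) {r : ℕ}
    (hn : n = 5 + 2 * r) :
    FailsWLPInDegree
      (powersAnd 4 (X (x 0) * X (x 1) * X (x 2) * X (x 3) : MvPolynomial (Fin n) K))
        (6 + r * 3) := by
  let y : Fin 4 ↪ Fin n := Fin.castSuccEmb.trans x
  have hprod : X (x 0) * X (x 1) * X (x 2) * X (x 3) = monomial (squarefreeExponent y) (1 : K) := by
    rw [monomial_squarefreeExponent, Fin.prod_univ_four]
    rfl
  have hV : Finset.univ.map y ∪ {x 4} = Finset.univ.map x := by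
    rw [← Finset.map_map, ← Finset.map_singleton, ← Finset.map_union]
    congr 1
  have hdisj : Disjoint (Finset.univ.map y) {x 4} := by
    rw [Finset.disjoint_singleton_right, ← Finset.map_map, Finset.mem_map']
    decide
  have hu := support_squarefreeExponent_subset y
  obtain ⟨f, hf⟩ := (isKernelForm_fourthPowers (K := K) y).exists_union (p := 0) (q := 3)
    (IsKernelForm.singleton (degree_squarefreeExponent y).ge (by norm_num) le_rfl (x 4)) hdisj hu
    le_rfl
  rw [hV] at hf
  rw [hprod]
  exact failsWLPInDegree_of_forms (by norm_num) (hu.trans (hV ▸ Finset.subset_union_left)) hf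
    (isDualForm_septicForm x) r (by simpa using hn)

end FourthPowers

section Cubes

variable {K : Type*} [Field K] {n : ℕ}

theorem isKernelForm_cubes (x : Fin 3 ↪ Fin n) :
    IsKernelForm (K := K) 3 (squarefreeExponent x) (Finset.univ.map x) 2 0 1
      (X (x 0) ^ 2 + X (x 1) ^ 2 + X (x 2) ^ 2 -
        X (x 0) * X (x 1) - X (x 1) * X (x 2) - X (x 2) * X (x 0)) := by
  set f : MvPolynomial (Fin n) K := X (x 0) ^ 2 + X (x 1) ^ 2 + X (x 2) ^ 2 -
    X (x 0) * X (x 1) - X (x 1) * X (x 2) - X (x 2) * X (x 0) with hf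
  have hhom : f.IsHomogeneous 2 := by
    have hmul (i j : Fin n) : (X i * X j : MvPolynomial (Fin n) K).IsHomogeneous 2 :=
      (isHomogeneous_X K i).mul (isHomogeneous_X K j)
    simp only [hf, sq]
    exact ((((hmul _ _).add (hmul _ _)).add (hmul _ _)).sub (hmul _ _) |>.sub (hmul _ _)).sub
      (hmul _ _)
  have hsupp : f ∈ supported K (Finset.univ.map x : Set (Fin n)) := by
    have hmul (i j : Fin 3) : (X (x i) * X (x j) : MvPolynomial (Fin n) K) ∈
        supported K (Finset.univ.map x : Set (Fin n)) :=
      mul_mem (X_mem_supported.mpr (by simp)) (X_mem_supported.mpr (by simp))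
    simp only [hf, sq]
    exact sub_mem (sub_mem (sub_mem (add_mem (add_mem (hmul _ _) (hmul _ _)) (hmul _ _))
      (hmul _ _)) (hmul _ _)) (hmul _ _)
  have hne : f ≠ 0 := fun h => by
    simpa [hf] using congrArg (eval (Pi.single (x 0) (1 : K))) h
  refine ⟨hhom, hsupp, ?_, ?_⟩
  · rw [pow_zero, one_mul]
    exact notMem_powersAnd_of_isHomogeneous hne hhom (by norm_num) (degree_squarefreeExponent x).ge
  · have hfactor : (∑ i ∈ Finset.univ.map x, X i) ^ 1 * f =
        X (x 0) ^ 3 + X (x 1) ^ 3 + X (x 2) ^ 3 -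
          3 * monomial (squarefreeExponent x) (1 : K) := by
      rw [monomial_squarefreeExponent, Fin.prod_univ_three, Finset.sum_map, Fin.sum_univ_three]
      ring
    rw [hfactor]
    exact sub_mem (add_mem (add_mem (X_pow_mem_powersAnd _ _) (X_pow_mem_powersAnd _ _))
      (X_pow_mem_powersAnd _ _)) (Ideal.mul_mem_left _ _ (self_mem_powersAnd _))

theorem isDualForm_cubes (x : Fin 3 ↪ Fin n) :
    IsDualForm (K := K) 3 (squarefreeExponent x) (Finset.univ.map x) 3
      ((X (x 0) - X (x 1)) ^ 1 * (X (x 0) - X (x 2)) ^ 1 * (X (x 1) - X (x 2)) ^ 1) where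
  __ := isInvariantForm_triangle (by simp) (by simp) (by simp) (by simp) (by simp) (by simp) 1 1
  isStandard a ha := by
    refine ⟨fun l => ((monomial_le_degreeOf l ha).trans
      (degreeOf_triangle_le (by simp) (by simp) (by simp) le_rfl l)).trans_lt (by norm_num), ?_⟩
    have hmem (i j k : Fin 3) (hki : k ≠ i) (hkj : k ≠ j) :
        (X (x i) * X (x j) * (X (x i) - X (x j)) : MvPolynomial (Fin n) K) ∈
          restrictSupport K {b | ¬ squarefreeExponent x ≤ b} := by
      have hi : (X (x i) : MvPolynomial (Fin n) K) ∈ supported K {x i, x j} :=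
        X_mem_supported.mpr (by simp)
      have hj : (X (x j) : MvPolynomial (Fin n) K) ∈ supported K {x i, x j} :=
        X_mem_supported.mpr (by simp)
      exact mem_restrictSupport_of_mem_supported (mul_mem (mul_mem hi hj) (sub_mem hi hj))
        (i := x k) (by simp [hki, hkj]) (by simp [squarefreeExponent_apply])
    have hexpand : ((X (x 0) - X (x 1)) ^ 1 * (X (x 0) - X (x 2)) ^ 1 * (X (x 1) - X (x 2)) ^ 1 :
        MvPolynomial (Fin n) K) = X (x 0) * X (x 1) * (X (x 0) - X (x 1)) -
          X (x 0) * X (x 2) * (X (x 0) - X (x 2)) + X (x 1) * X (x 2) * (X (x 1) - X (x 2)) := by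
      ring
    rw [hexpand] at ha
    exact (mem_restrictSupport_iff K).mp (add_mem (sub_mem (hmem 0 1 2 (by decide) (by decide))
      (hmem 0 2 1 (by decide) (by decide))) (hmem 1 2 0 (by decide) (by decide))) ha

theorem failsWLPInDegree_cubes [CharZero K] (x : Fin 3 ↪ Fin n) {r : ℕ} (hn : n = 3 + 2 * r) :
    FailsWLPInDegree (powersAnd 3 (X (x 0) * X (x 1) * X (x 2) : MvPolynomial (Fin n) K))
      (2 + r * 2) := by
  rw [← Fin.prod_univ_three (fun i => (X (x i) : MvPolynomial (Fin n) K)),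
    ← monomial_squarefreeExponent]
  exact failsWLPInDegree_of_forms (by norm_num) (support_squarefreeExponent_subset x)
    (isKernelForm_cubes x) (isDualForm_cubes x) r (by simpa using hn)

end Cubes

theorem proposition5p9 (K : Type*) [Field K] [CharZero K] (n m : ℕ) (hnm : n = 2 * m + 1) :
    (∀ (d : ℕ) (_ : 5 ≤ d) (hn : 5 ≤ n),
      FailsWLPInDegree
        (powersAnd d
          ((MvPolynomial.X ⟨0, by omega⟩ ^ ((d + 1) / 2) *
            MvPolynomial.X ⟨1, by omega⟩ ^ (d / 2) : MvPolynomial (Fin n) K)))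
        ((n * (d - 1)) / 2 - 1)) ∧
    (∀ hn : 5 ≤ n,
      FailsWLPInDegree
        (powersAnd 4
          ((MvPolynomial.X ⟨0, by omega⟩ * MvPolynomial.X ⟨1, by omega⟩ *
            MvPolynomial.X ⟨2, by omega⟩ * MvPolynomial.X ⟨3, by omega⟩ :
              MvPolynomial (Fin n) K)))
        (3 * m)) ∧
    (∀ hn : 3 ≤ n,
      FailsWLPInDegree
        (powersAnd 3
          ((MvPolynomial.X ⟨0, by omega⟩ * MvPolynomial.X ⟨1, by omega⟩ *
            MvPolynomial.X ⟨2, by omega⟩ : MvPolynomial (Fin n) K)))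
        (2 * m)) := by
  refine ⟨fun d hd hn => ?_, fun hn => ?_, fun hn => ?_⟩
  · have hdeg : n * (d - 1) / 2 - 1 = 2 * (d - 2) + (d + 1) / 2 + (m - 2) * (d - 1) := by
      obtain ⟨r, rfl⟩ : ∃ r, m = r + 2 := Nat.exists_eq_add_of_le' (by omega)
      have hsplit : n * (d - 1) = 2 * (r * (d - 1)) + 5 * (d - 1) := by
        rw [hnm]
        ring
      rw [hsplit, Nat.add_sub_cancel]
      omega
    rw [hdeg]
    exact failsWLPInDegree_of_two_variable_monomial hd (Fin.castLEEmb hn) (by omega)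
  · have hdeg : 3 * m = 6 + (m - 2) * 3 := by omega
    rw [hdeg]
    exact failsWLPInDegree_fourthPowers (Fin.castLEEmb hn) (by omega)
  · have hdeg : 2 * m = 2 + (m - 1) * 2 := by omega
    rw [hdeg]
    exact failsWLPInDegree_cubes (Fin.castLEEmb hn) (by omega)
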